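/- **Theorem 2.2.** Let $n\in\mathbb N$ and $\alpha>0$, and let $F^2_\alpha(\mathbb{C}^n)$ be the Fock space, i.e. the Hilbert space of all entire functions $f:\mathbb{C}^n\to\mathbb{C}$ with $$\|f\|^2=\int_{\mathbb{C}^n}|f(z)|^2\,\Bigl(\frac{\alpha}{\pi}\Bigr)^n e^{-\alpha|z|^2}\,dv(z)<\infty,$$ where $v$ is Lebesgue measure on $\mathbb{C}^n$; the classical Fock space $F^2(\mathbb{C}^n)$ is the case $\alpha=1/2$. Let $\varphi:\mathbb{C}^n\to\mathbb{C}^n$ be a holomorphic mapping such that $C_\varphi f=f\circ\varphi$ maps $F^2_\alpha(\mathbb{C}^n)$ into itself and $C_\varphi$ is a compact operator on $F^2_\alpha(\mathbb{C}^n)$. Then for every $0<p<\infty$ the operator $C_\varphi$ belongs to the Schatten class $S_p$; that is, there are orthonormal systems $(e_i)_{i\in I}$ and $(u_i)_{i\in I}$ in $F^2_\alpha(\mathbb{C}^n)$, with $I$ finite or countably infinite, and positive numbers $(s_i)_{i\in I}$ (the nonzero singular values of $C_\varphi$) such that $$C_\varphi f=\sum_{i\in I}s_i\,\langle f,e_i\rangle\,u_i\quad\text{for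 all } f\in F^2_\alpha(\mathbb{C}^n),\qquad\text{and}\qquad \sum_{i\in I}s_i^{\,p}<\infty .$$ -/

import Mathlib

open MeasureTheory
open scoped ComplexConjugate

noncomputable section

/-- The Gaussian measure `(α/π)^n exp(-α|z|²) dv(z)` on `ℂⁿ`, where `|z|² = ∑ |z_j|²` and `v` is
Lebesgue measure. -/
def fockMeasure (n : ℕ) (α : ℝ) : Measure (Fin n → ℂ) :=
  (volume : Measure (Fin n → ℂ)).withDensity fun z =>
    ENNReal.ofReal ((α / Real.pi) ^ n * Real.exp (-α * ∑ j, ‖z j‖ ^ 2))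

/-- The entire functions on `ℂⁿ` that are square integrable for the Gaussian measure. -/
def fockSubmodule (n : ℕ) (α : ℝ) : Submodule ℂ ((Fin n → ℂ) → ℂ) where
  carrier := {f | Differentiable ℂ f ∧ MemLp f 2 (fockMeasure n α)}
  add_mem' hf hg := ⟨hf.1.add hg.1, hf.2.add hg.2⟩
  zero_mem' := ⟨differentiable_const 0, MemLp.zero⟩
  smul_mem' c _ hf := ⟨hf.1.const_smul c, hf.2.const_smul c⟩

/-- The Fock space `F²_α(ℂⁿ)`. This is a separate type, so that it carries the topology of its
own norm and not the topology of pointwise convergence. -/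
def FockSpace (n : ℕ) (α : ℝ) : Type := fockSubmodule n α

namespace FockSpace

variable {n : ℕ} {α : ℝ}

instance : AddCommGroup (FockSpace n α) := inferInstanceAs (AddCommGroup (fockSubmodule n α))

instance : Module ℂ (FockSpace n α) := inferInstanceAs (Module ℂ (fockSubmodule n α))

instance : CoeFun (FockSpace n α) (fun _ => (Fin n → ℂ) → ℂ) := ⟨Subtype.val⟩

theorem mem (f : FockSpace n α) : (f : (Fin n → ℂ) → ℂ) ∈ fockSubmodule n α := Subtype.property f

theorem memLp (f : FockSpace n α) : MemLp (f : (Fin n → ℂ) → ℂ) 2 (fockMeasure n α) := f.mem.2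

theorem integrable_conj_mul (f g : FockSpace n α) :
    Integrable (fun z => conj (f z) * g z) (fockMeasure n α) :=
  MemLp.integrable_mul (p := 2) (q := 2) f.memLp.star g.memLp

/-- The integral `∫ conj f · g` against the Gaussian measure; as everywhere in Mathlib, the inner
product is linear in the second variable. -/
instance : Inner ℂ (FockSpace n α) :=
  ⟨fun f g => ∫ z, conj (f z) * g z ∂(fockMeasure n α)⟩

theorem inner_def (f g : FockSpace n α) :
    inner ℂ f g = ∫ z, conj (f z) * g z ∂(fockMeasure n α) := rfl

theorem inner_self (f : FockSpace n α) :
    inner ℂ f f = ((∫ z, ‖f z‖ ^ 2 ∂(fockMeasure n α) : ℝ) : ℂ) := by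
  rw [inner_def, ← integral_complex_ofReal]
  congr 1
  ext z
  rw [Complex.conj_mul']
  push_cast
  rfl

theorem eq_zero_of_inner_self [hα : Fact (0 < α)] (f : FockSpace n α)
    (h : inner ℂ f f = 0) : f = 0 := by
  rw [inner_self, Complex.ofReal_eq_zero,
    integral_eq_zero_iff_of_nonneg (fun z => sq_nonneg _) ((memLp_two_iff_integrable_sq_norm f.memLp.1).1 f.memLp)] at h
  have hac : (volume : Measure (Fin n → ℂ)) ≪ fockMeasure n α := by
    refine withDensity_absolutelyContinuous' (Measurable.aemeasurable (by fun_prop)) ?_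
    refine Filter.Eventually.of_forall fun z => ?_
    have := hα.out
    have : 0 < (α / Real.pi) ^ n * Real.exp (-α * ∑ j, ‖z j‖ ^ 2) := by positivity
    simpa using this
  have h2 : (f : (Fin n → ℂ) → ℂ) =ᵐ[volume] (fun _ => (0 : ℂ)) := by
    filter_upwards [hac.ae_le h] with z hz
    simpa using hz
  have h3 := (Continuous.ae_eq_iff_eq volume f.mem.1.continuous continuous_const).1 h2
  exact Subtype.ext h3

instance instCore [Fact (0 < α)] : InnerProductSpace.Core ℂ (FockSpace n α) where
  conj_inner_symm f g := by
    rw [inner_def, inner_def, ← integral_conj]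
    congr 1
    ext z
    simp [mul_comm]
  re_inner_nonneg f := by
    rw [inner_self]
    exact integral_nonneg fun z => sq_nonneg _
  add_left f g h := by
    rw [inner_def, inner_def, inner_def,
      ← integral_add (integrable_conj_mul f h) (integrable_conj_mul g h)]
    congr 1
    ext z
    change conj (f z + g z) * h z = _
    rw [map_add, add_mul]
  smul_left f g c := by
    rw [inner_def, inner_def, ← integral_const_mul]
    congr 1
    ext z
    change conj (c * f z) * g z = _
    rw [map_mul, mul_assoc]
  definite f h := eq_zero_of_inner_self f h

/-- The norm is `‖f‖ = (∫ |f|²)^{1/2}`, taken against the Gaussian measure. -/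
instance [Fact (0 < α)] : NormedAddCommGroup (FockSpace n α) :=
  (instCore (n := n) (α := α)).toNormedAddCommGroup

instance [Fact (0 < α)] : InnerProductSpace ℂ (FockSpace n α) :=
  InnerProductSpace.ofCore instCore.toCore

end FockSpace

/-- The composition operator `C_φ f = f ∘ φ` on the Fock space, for a map `φ` such that `f ∘ φ`
lies in the Fock space whenever `f` does. -/
def compositionOperator {n : ℕ} {α : ℝ} (φ : (Fin n → ℂ) → (Fin n → ℂ))
    (hφ : ∀ f : FockSpace n α, (f : (Fin n → ℂ) → ℂ) ∘ φ ∈ fockSubmodule n α) :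
    FockSpace n α →ₗ[ℂ] FockSpace n α where
  toFun f := ⟨(f : (Fin n → ℂ) → ℂ) ∘ φ, hφ f⟩
  map_add' _ _ := rfl
  map_smul' _ _ := rfl

/-- `T` belongs to the Schatten class `S_p`: it is compact and has a singular value decomposition
`T x = ∑ s_i ⟨x, e_i⟩ u_i`, with finite or countably infinite orthonormal systems `e`, `u` and
positive singular values `s_i`, for which `∑ s_i ^ p` converges. -/
def MemSchatten {H : Type*} [NormedAddCommGroup H] [InnerProductSpace ℂ H] (p : ℝ)
    (T : H →ₗ[ℂ] H) : Prop :=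
  IsCompactOperator T ∧
    ∃ (I : Set ℕ) (e u : I → H) (s : I → ℝ),
      Orthonormal ℂ e ∧ Orthonormal ℂ u ∧ (∀ i, 0 < s i) ∧
      (∀ x, HasSum (fun i => ((s i : ℂ) * inner ℂ (e i) x) • u i) (T x)) ∧
      Summable fun i => s i ^ p

end

/-! The symbol of a compact composition operator is forced to be affine with strictly contractive
linear part, and composition with such a map factors into as many Hilbert–Schmidt operators as
desired.

Boundedness, tested on reproducing kernels, gives |φ(w)|² ≤ |w|² + C (`exists_sqNorm_symbol_le`), so
φ is affine by a Liouville argument (`symbol_eq_affine`). If the linear part did not shrink some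
vector ζ, normalized kernels at the points φ(jζ) would tend to zero pointwise while their images
kept norm at least 1, against compactness (`sqNorm_linear_lt_of_compact`). Hence |φ(z)|² ≤ τ|z|² + C
with τ < 1.

For such a map the diagonal of the reproducing kernel at φ(z) is integrable, which is a
Hilbert–Schmidt bound (`exists_sum_norm_sq_le`). Some of the contraction can be split off as a
dilation, leaving a map of the same kind (`exists_factorization`). Each Hilbert–Schmidt factor
contributes k^(-1/2) to the decay of the Gelfand numbers (`gelfandDecay`). These dominate the
singular values, which therefore decay faster than every power and are p-summable for every p > 0
(`GelfandDecay.memSchatten`). -/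

noncomputable section

/-! ### Singular values and Gelfand numbers on a Hilbert space. -/

section Hilbert

universe u

variable {H : Type u} [NormedAddCommGroup H] [InnerProductSpace ℂ H]

/-- A compact operator on a Hilbert space maps some Hilbert basis to an orthogonal family. -/
theorem IsCompactOperator.exists_hilbertBasis_orthogonal_image [CompleteSpace H] {T : H →L[ℂ] H}
    (hT : IsCompactOperator T) :
    ∃ (ι : Type u) (v : HilbertBasis ι ℂ H),
      Pairwise fun i j => inner ℂ (T (v i)) (T (v j)) = 0 := by
  classical
  set S : H →L[ℂ] H := (ContinuousLinearMap.adjoint T) ∘L T with hS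
  have hSc : IsCompactOperator S := hT.clm_comp (ContinuousLinearMap.adjoint T)
  have hin : ∀ x y, inner ℂ (S x) y = inner ℂ (T x) (T y) := fun x y => by
    rw [hS, ContinuousLinearMap.comp_apply, ContinuousLinearMap.adjoint_inner_left]
  have hin' : ∀ x y, inner ℂ x (S y) = inner ℂ (T x) (T y) := fun x y => by
    rw [hS, ContinuousLinearMap.comp_apply, ContinuousLinearMap.adjoint_inner_right]
  have hsym : (S : H →ₗ[ℂ] H).IsSymmetric := fun x y => (hin x y).trans (hin' x y).symm
  have hbot := ContinuousLinearMap.orthogonalComplement_iSup_eigenspaces_eq_bot hSc hsym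
  have hfam := hsym.orthogonalFamily_eigenspaces
  have hcs : ∀ μ : ℂ, CompleteSpace (Module.End.eigenspace (S : H →ₗ[ℂ] H) μ) := fun μ => by
    have hcl : IsClosed (Module.End.eigenspace (S : H →ₗ[ℂ] H) μ : Set H) := by
      have : (Module.End.eigenspace (S : H →ₗ[ℂ] H) μ : Set H) = {x | S x = μ • x} := by
        ext x; simp
      rw [this]
      exact isClosed_eq S.continuous (continuous_const_smul μ)
    exact hcl.completeSpace_coe
  -- Bases of all eigenspaces of T*T are glued together; μ = 0 is included, so the kernel is covered
  -- and may be infinite-dimensional.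
  choose w b hb using fun μ : ℂ =>
    exists_hilbertBasis ℂ (Module.End.eigenspace (S : H →ₗ[ℂ] H) μ)
  have horth : Orthonormal ℂ
      (fun a : Σ μ : ℂ, w μ => ((b a.1 a.2 : Module.End.eigenspace (S : H →ₗ[ℂ] H) a.1) : H)) :=
    hfam.orthonormal_sigma_orthonormal (fun μ => (b μ).orthonormal)
  refine ⟨Σ μ : ℂ, w μ, HilbertBasis.mkOfOrthogonalEqBot horth ?_, ?_⟩
  · rw [eq_bot_iff, ← hbot]
    intro x hx
    rw [Submodule.mem_orthogonal] at hx
    rw [← Submodule.iInf_orthogonal, Submodule.mem_iInf]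
    intro μ
    have h1 : (Submodule.span ℂ (Set.range (b μ))).map
        (Module.End.eigenspace (S : H →ₗ[ℂ] H) μ).subtype ≤ (ℂ ∙ x)ᗮ := by
      rw [Submodule.map_span, Submodule.span_le]
      rintro _ ⟨_, ⟨i, rfl⟩, rfl⟩
      rw [SetLike.mem_coe, Submodule.mem_orthogonal_singleton_iff_inner_left]
      exact hx _ (Submodule.subset_span ⟨⟨μ, i⟩, rfl⟩)
    rw [Submodule.mem_orthogonal]
    intro y hy
    have h2 : (⟨y, hy⟩ : Module.End.eigenspace (S : H →ₗ[ℂ] H) μ) ∈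
        (Submodule.span ℂ (Set.range (b μ))).topologicalClosure := by
      rw [(b μ).dense_span]; trivial
    have h3 : IsClosed {z : Module.End.eigenspace (S : H →ₗ[ℂ] H) μ | inner ℂ (z : H) x = 0} :=
      isClosed_eq (by fun_prop) continuous_const
    have h4 : (Submodule.span ℂ (Set.range (b μ)) : Set _) ⊆
        {z : Module.End.eigenspace (S : H →ₗ[ℂ] H) μ | inner ℂ (z : H) x = 0} := fun z hz =>
      (Submodule.mem_orthogonal_singleton_iff_inner_left).1 (h1 ⟨z, hz, rfl⟩)
    exact closure_minimal h4 h3 h2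
  · intro i j hij
    rw [HilbertBasis.coe_mkOfOrthogonalEqBot]
    have hj : S (b j.1 j.2 : H) = j.1 • (b j.1 j.2 : H) :=
      Module.End.mem_eigenspace_iff.1 (b j.1 j.2).2
    rw [← hin', hj, inner_smul_right, horth.2 hij, mul_zero]

/-- `T` is bounded by `ε` on the common kernel of some `k` linear functionals, that is, the Gelfand
number of `T` of index `k` is at most `ε`. -/
def GelfandBound (T : H →ₗ[ℂ] H) (k : ℕ) (ε : ℝ) : Prop :=
  ∃ s : Finset (Module.Dual ℂ H), s.card ≤ k ∧ ∀ x, (∀ l ∈ s, l x = 0) → ‖T x‖ ≤ ε * ‖x‖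

/-- Pulling the functionals for `S` back along `T` and adding those for `T` makes the indices add
and the bounds multiply. -/
theorem GelfandBound.comp {S T : H →ₗ[ℂ] H} {k l : ℕ} {ε δ : ℝ} (hε : 0 ≤ ε)
    (hS : GelfandBound S k ε) (hT : GelfandBound T l δ) : GelfandBound (S ∘ₗ T) (k + l) (ε * δ) := by
  classical
  obtain ⟨s, hs, hs'⟩ := hS
  obtain ⟨t, ht, ht'⟩ := hT
  refine ⟨s.image (fun l => l ∘ₗ T) ∪ t, (Finset.card_union_le _ _).trans
    (add_le_add (Finset.card_image_le.trans hs) ht), fun x hx => ?_⟩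
  have h1 := hs' (T x) fun l hl =>
    hx (l ∘ₗ T) (Finset.mem_union_left _ (Finset.mem_image_of_mem _ hl))
  have h2 := ht' x fun l hl => hx l (Finset.mem_union_right _ hl)
  calc ‖S (T x)‖ ≤ ε * ‖T x‖ := h1
    _ ≤ ε * (δ * ‖x‖) := mul_le_mul_of_nonneg_left h2 hε
    _ = ε * δ * ‖x‖ := (mul_assoc _ _ _).symm

/-- If `∑ ‖T e_i‖² ≤ M` for every finite orthonormal system, then the Gelfand numbers of `T` decay
like those of a Hilbert–Schmidt operator. -/
theorem gelfandBound_of_sum_sq_le {T : H →ₗ[ℂ] H} {M : ℝ} (hM : 0 ≤ M)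
    (h : ∀ (m : ℕ) (e : Fin m → H), Orthonormal ℂ e → ∑ i, ‖T (e i)‖ ^ 2 ≤ M) (k : ℕ) :
    GelfandBound T k √(M / (k + 1)) := by
  classical
  -- Orthonormal systems on which `T` is large have at most k members. For one of maximal length, a
  -- unit vector orthogonal to it and violating the bound could be appended.
  set P : ℕ → Prop := fun m =>
    ∃ e : Fin m → H, Orthonormal ℂ e ∧ ∀ i, M / (k + 1) < ‖T (e i)‖ ^ 2 with hP
  have hk : (0 : ℝ) < k + 1 := by positivity
  have hbd : ∀ m, P m → m ≤ k := by
    rintro m ⟨e, he, hlt⟩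
    by_contra! hkm
    have h1 : ∑ i : Fin m, M / (k + 1) < ∑ i, ‖T (e i)‖ ^ 2 :=
      Finset.sum_lt_sum_of_nonempty ⟨⟨0, by omega⟩, Finset.mem_univ _⟩ fun i _ => hlt i
    have h2 := h m e he
    rw [Finset.sum_const, Finset.card_univ, Fintype.card_fin, nsmul_eq_mul] at h1
    have h3 : M ≤ m * (M / (k + 1)) := by
      rw [mul_div_assoc', le_div_iff₀ hk, mul_comm]
      exact mul_le_mul_of_nonneg_right (by exact_mod_cast hkm) hM
    linarith
  have h0 : P 0 := ⟨Fin.elim0, ⟨fun i => i.elim0, fun i => i.elim0⟩, fun i => i.elim0⟩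
  obtain ⟨m, ⟨e, he, hlt⟩, hmax⟩ : ∃ m, P m ∧ ¬ P (m + 1) :=
    ⟨Nat.findGreatest P k, Nat.findGreatest_spec (Nat.zero_le k) h0, fun hs =>
      absurd (Nat.le_findGreatest (hbd _ hs) hs) (by simp)⟩
  refine ⟨Finset.univ.image fun i => (innerₛₗ ℂ (e i) : Module.Dual ℂ H),
    (Finset.card_image_le.trans (by simpa using hbd m ⟨e, he, hlt⟩)), fun x hx => ?_⟩
  have hx' : ∀ i, inner ℂ (e i) x = 0 := fun i =>
    hx _ (Finset.mem_image_of_mem _ (Finset.mem_univ i))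
  by_contra! hcon
  have hx0 : x ≠ 0 := by
    rintro rfl
    simp at hcon
  have hn : 0 < ‖x‖ := norm_pos_iff.2 hx0
  have hsucc : P (m + 1) := by
    refine ⟨Fin.cons (((‖x‖ : ℂ)⁻¹) • x) e, ?_, ?_⟩
    · constructor
      · intro i
        refine Fin.cases ?_ (fun i => ?_) i
        · simp [norm_smul, hn.ne']
        · simpa using he.1 i
      · intro i j
        refine Fin.cases ?_ (fun i => ?_) i <;> refine Fin.cases ?_ (fun j => ?_) j
        · simp
        · intro _
          simp [inner_smul_left, inner_eq_zero_symm.1 (hx' j)]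
        · intro _
          simp [inner_smul_right, hx' i]
        · intro hij
          simpa using he.2 (fun hh => hij (by rw [hh]))
    · intro i
      refine Fin.cases ?_ (fun i => ?_) i
      · have h1 : √(M / (k + 1)) < ‖T (((‖x‖ : ℂ)⁻¹) • x)‖ := by
          rw [map_smul, norm_smul, norm_inv, Complex.norm_real, norm_norm, inv_mul_eq_div,
            lt_div_iff₀ hn]
          exact hcon
        simpa using (Real.sqrt_lt' ((Real.sqrt_nonneg _).trans_lt h1)).1 h1
      · simpa using hlt i
  exact hmax hsucc

theorem norm_sq_sum_of_pairwise_orthogonal {ι : Type*} [Fintype ι] {v : ι → H}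
    (hv : Pairwise fun i j => inner ℂ (v i) (v j) = 0) (a : ι → ℂ) :
    ‖∑ i, a i • v i‖ ^ 2 = ∑ i, ‖a i‖ ^ 2 * ‖v i‖ ^ 2 := by
  classical
  have h : (inner ℂ (∑ i, a i • v i) (∑ i, a i • v i) : ℂ) =
      ((∑ i, ‖a i‖ ^ 2 * ‖v i‖ ^ 2 : ℝ) : ℂ) := by
    rw [sum_inner, Complex.ofReal_sum]
    refine Finset.sum_congr rfl fun i _ => ?_
    rw [inner_sum, Finset.sum_eq_single i]
    · rw [inner_smul_left, inner_smul_right, inner_self_eq_norm_sq_to_K, ← mul_assoc,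
        Complex.conj_mul']
      push_cast
      rfl
    · intro j _ hj
      rw [inner_smul_left, inner_smul_right, hv hj.symm, mul_zero, mul_zero]
    · simp
  rw [inner_self_eq_norm_sq_to_K] at h
  exact Complex.ofReal_injective (by simpa using h)

/-- The least of more than `k` singular values is at most the Gelfand number of index `k`. -/
theorem GelfandBound.exists_norm_le {T : H →ₗ[ℂ] H} {k : ℕ} {ε : ℝ} (hε : 0 ≤ ε)
    (hT : GelfandBound T k ε) {ι : Type*} {v : ι → H} (hv : Orthonormal ℂ v)
    (hTv : Pairwise fun i j => inner ℂ (T (v i)) (T (v j)) = 0) (F : Finset ι) (hF : k < F.card) :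
    ∃ i ∈ F, ‖T (v i)‖ ≤ ε := by
  classical
  obtain ⟨s, hs, hs'⟩ := hT
  by_contra! hcon
  -- Dimension count: more than k vectors span a nonzero `x` killed by all the functionals.
  -- Orthogonality of the `v i` and of their images then gives ‖T x‖ > ε‖x‖.
  set L : (F → ℂ) →ₗ[ℂ] (s → ℂ) :=
    LinearMap.pi fun l => (l : Module.Dual ℂ H) ∘ₗ Fintype.linearCombination ℂ fun i : F => v i
    with hL
  have hker : LinearMap.ker L ≠ ⊥ := by
    apply LinearMap.ker_ne_bot_of_finrank_lt
    simpa using lt_of_le_of_lt hs hF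
  obtain ⟨a, ha, ha0⟩ := Submodule.exists_mem_ne_zero_of_ne_bot hker
  set x : H := ∑ i : F, a i • v i with hx
  have hxl : ∀ l ∈ s, l x = 0 := fun l hl => by
    have := congrFun (LinearMap.mem_ker.1 ha) ⟨l, hl⟩
    simpa [hL, Fintype.linearCombination_apply, hx] using this
  have hnx : ‖x‖ ^ 2 = ∑ i : F, ‖a i‖ ^ 2 := by
    rw [hx, norm_sq_sum_of_pairwise_orthogonal fun i j hij => hv.2 (Subtype.coe_ne_coe.2 hij)]
    simp [hv.1]
  have hnT : ‖T x‖ ^ 2 = ∑ i : F, ‖a i‖ ^ 2 * ‖T (v i)‖ ^ 2 := by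
    simp_rw [hx, map_sum, map_smul]
    exact norm_sq_sum_of_pairwise_orthogonal (fun i j hij => hTv (Subtype.coe_ne_coe.2 hij)) a
  have hle : ‖T x‖ ^ 2 ≤ ε ^ 2 * ‖x‖ ^ 2 := by
    rw [← mul_pow]
    exact pow_le_pow_left₀ (norm_nonneg _) (hs' x hxl) 2
  have hsq : ∀ i : F, ε ^ 2 < ‖T (v i)‖ ^ 2 := fun i =>
    pow_lt_pow_left₀ (hcon i i.2) hε two_ne_zero
  obtain ⟨i, hi⟩ := Function.ne_iff.1 ha0
  rw [hnT, hnx, Finset.mul_sum] at hle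
  refine absurd hle (not_le.2 (Finset.sum_lt_sum (fun j _ => ?_) ⟨i, Finset.mem_univ _, ?_⟩))
  · rw [mul_comm]
    exact mul_le_mul_of_nonneg_left (hsq j).le (sq_nonneg _)
  · rw [mul_comm]
    exact mul_lt_mul_of_pos_left (hsq i) (by have := norm_pos_iff.2 hi; positivity)

/-- A family is summable if the least of any `N` of its terms is at most `C / N²`. -/
theorem summable_of_forall_finset_exists_le {ι : Type*} {f : ι → ℝ} (hf : ∀ i, 0 ≤ f i) {C : ℝ}
    (h : ∀ F : Finset ι, F.Nonempty → ∃ i ∈ F, f i ≤ C * (1 / (F.card : ℝ) ^ 2)) : Summable f := by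
  classical
  have key : ∀ (N : ℕ) (F : Finset ι), F.card = N →
      ∑ i ∈ F, f i ≤ ∑ j ∈ Finset.range N, C * (1 / ((j + 1 : ℕ) : ℝ) ^ 2) := by
    intro N
    induction N with
    | zero =>
      intro F hF
      simp [Finset.card_eq_zero.1 hF]
    | succ N ih =>
      intro F hF
      -- Removing the small term from a set of N + 1 elements costs at most C / (N + 1)².
      obtain ⟨i, hi, hfi⟩ := h F (Finset.card_pos.1 (by omega))
      rw [← Finset.sum_erase_add F f hi, Finset.sum_range_succ]
      exact add_le_add (ih _ (by rw [Finset.card_erase_of_mem hi, hF]; rfl)) (hF ▸ hfi)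
  rcases isEmpty_or_nonempty ι with hι | ⟨⟨i₀⟩⟩
  · exact (hasSum_empty (f := f)).summable
  have hC : 0 ≤ C := by
    obtain ⟨i, _, hfi⟩ := h {i₀} ⟨i₀, by simp⟩
    simpa using (hf i).trans hfi
  have hsum : Summable fun j : ℕ => C * (1 / ((j + 1 : ℕ) : ℝ) ^ 2) :=
    ((summable_nat_add_iff 1).2 (Real.summable_one_div_nat_pow.2 one_lt_two)).mul_left C
  refine summable_of_sum_le hf (c := ∑' j : ℕ, C * (1 / ((j + 1 : ℕ) : ℝ) ^ 2)) fun F => ?_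
  exact (key _ F rfl).trans (hsum.sum_le_tsum _ fun j _ => by positivity)

/-- Gelfand numbers that decay like `k ^ (-m / 2)`. -/
def GelfandDecay (T : H →ₗ[ℂ] H) (m : ℕ) : Prop :=
  ∃ M : ℝ, 0 ≤ M ∧ ∀ k : ℕ, GelfandBound T (m * k) (M / √(k + 1) ^ m)

theorem GelfandDecay.summable {T : H →ₗ[ℂ] H} (hT : ∀ m, GelfandDecay T m) {ι : Type*} {v : ι → H}
    (hv : Orthonormal ℂ v) (hTv : Pairwise fun i j => inner ℂ (T (v i)) (T (v j)) = 0)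
    {p : ℝ} (hp : 0 < p) : Summable fun i => ‖T (v i)‖ ^ p := by
  -- The p-th powers decay with exponent m p / 2, which now exceeds 2.
  obtain ⟨m, hm⟩ := exists_nat_gt (4 / p)
  have hm0 : (0 : ℝ) < m := lt_trans (by positivity) hm
  have hm1 : 0 < m := by exact_mod_cast hm0
  obtain ⟨M, hM, h⟩ := hT m
  refine summable_of_forall_finset_exists_le (fun i => by positivity)
    (C := M ^ p * ((m : ℝ) ^ ((m : ℝ) * p / 2))) fun F hF => ?_
  have hN : 0 < F.card := Finset.card_pos.2 hF
  set N := F.card with hNdef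
  -- The largest k with m * k < N: the number of functionals must be strictly less than N, while N ≤
  -- m * (k + 1) turns decay in k into decay in N.
  set k := (N - 1) / m with hk
  have hk1 : m * k < N := by
    have := Nat.mul_div_le (N - 1) m
    rw [← hk] at this
    omega
  have hk2 : N ≤ m * (k + 1) := by
    have := Nat.lt_mul_div_succ (N - 1) hm1
    rw [← hk] at this
    omega
  obtain ⟨i, hi, hle⟩ := (h k).exists_norm_le (by positivity) hv hTv F hk1
  refine ⟨i, hi, (Real.rpow_le_rpow (norm_nonneg _) hle hp.le).trans ?_⟩
  have hk0 : (0 : ℝ) < k + 1 := by positivity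
  have hNr : (1 : ℝ) ≤ N := by exact_mod_cast hN
  have hpow : (√((k : ℝ) + 1) ^ m) ^ p = ((k : ℝ) + 1) ^ ((m : ℝ) * p / 2) := by
    rw [Real.sqrt_eq_rpow, ← Real.rpow_natCast, ← Real.rpow_mul hk0.le, ← Real.rpow_mul hk0.le]
    congr 1
    ring
  rw [Real.div_rpow hM (by positivity), hpow, mul_assoc, div_eq_mul_one_div]
  refine mul_le_mul_of_nonneg_left ?_ (by positivity)
  rw [mul_one_div, div_le_div_iff₀ (by positivity) (by positivity), one_mul,
    ← Real.mul_rpow hm0.le hk0.le]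
  calc (N : ℝ) ^ 2 = (N : ℝ) ^ (2 : ℝ) := by norm_cast
    _ ≤ (N : ℝ) ^ ((m : ℝ) * p / 2) := by
      refine Real.rpow_le_rpow_of_exponent_le hNr ?_
      rw [div_lt_iff₀ hp] at hm
      linarith
    _ ≤ ((m : ℝ) * (k + 1)) ^ ((m : ℝ) * p / 2) :=
      Real.rpow_le_rpow (by positivity) (by exact_mod_cast hk2) (by positivity)

theorem GelfandDecay.memSchatten [CompleteSpace H] {T : H →ₗ[ℂ] H} (hc : IsCompactOperator T)
    (hT : ∀ m, GelfandDecay T m) {p : ℝ} (hp : 0 < p) : MemSchatten p T := by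
  refine ⟨hc, ?_⟩
  obtain ⟨ι, v, hv⟩ := IsCompactOperator.exists_hilbertBasis_orthogonal_image
    (T := (⟨T, hc.continuous⟩ : H →L[ℂ] H)) hc
  replace hv : Pairwise fun i j => inner ℂ (T (v i)) (T (v j)) = 0 := hv
  have hsum := GelfandDecay.summable hT v.orthonormal hv hp
  set J : Set ι := {i | T (v i) ≠ 0} with hJ
  have hpos : ∀ i : J, 0 < ‖T (v i)‖ := fun i => norm_pos_iff.2 i.2
  -- The space is not assumed separable; summability makes the set of nonzero singular values
  -- countable.
  have hJc : J.Countable := by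
    refine hsum.countable_support.mono fun i hi => ?_
    exact (Real.rpow_pos_of_pos (norm_pos_iff.2 hi) p).ne'
  have := hJc.to_subtype
  obtain ⟨g, hg⟩ := exists_injective_nat J
  set E : J ≃ Set.range g := Equiv.ofInjective g hg with hE
  refine ⟨Set.range g, fun i => v (E.symm i),
    fun i => ((‖T (v (E.symm i))‖ : ℂ)⁻¹) • T (v (E.symm i)), fun i => ‖T (v (E.symm i))‖,
    v.orthonormal.comp _ (Subtype.val_injective.comp E.symm.injective), ⟨fun i => ?_,
      fun i j hij => ?_⟩, fun i => hpos _, fun x => ?_, ?_⟩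
  · rw [norm_smul, norm_inv, Complex.norm_real, norm_norm, inv_mul_cancel₀ (hpos _).ne']
  · beta_reduce
    rw [inner_smul_left, inner_smul_right,
      hv (Subtype.coe_ne_coe.2 (E.symm.injective.ne hij)), mul_zero, mul_zero]
  · have h1 : HasSum (fun i => (inner ℂ (v i) x) • T (v i)) (T x) := by
      have := (v.hasSum_repr x).mapL (⟨T, hc.continuous⟩ : H →L[ℂ] H)
      simpa [HilbertBasis.repr_apply_apply] using this
    have h2 : HasSum (fun i : J => (inner ℂ (v i) x) • T (v i)) (T x) := by
      refine (hasSum_subtype_iff_of_support_subset ?_).2 h1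
      intro i hi h0
      exact hi (by simp [h0])
    rw [← E.symm.hasSum_iff] at h2
    convert h2 using 2 with i
    have : (‖T (v (E.symm i))‖ : ℂ) ≠ 0 := Complex.ofReal_ne_zero.2 (hpos _).ne'
    rw [smul_smul, Function.comp_apply, mul_right_comm, mul_inv_cancel₀ this, one_mul]
  · exact (hsum.comp_injective Subtype.val_injective).comp_injective E.symm.injective

end Hilbert

/-! ### The Gaussian measure and its mean value property. -/

section Gaussian

variable {n : ℕ} {α : ℝ}

/-- The square of the Euclidean norm on `ℂⁿ`. -/
def sqNorm (z : Fin n → ℂ) : ℝ := ∑ j, ‖z j‖ ^ 2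

/-- The standard Hermitian form on `ℂⁿ`, linear in the second variable. -/
def hermForm (w z : Fin n → ℂ) : ℂ := ∑ j, conj (w j) * z j

theorem sqNorm_nonneg (z : Fin n → ℂ) : 0 ≤ sqNorm z := Finset.sum_nonneg fun _ _ => sq_nonneg _

theorem continuous_sqNorm : Continuous (sqNorm : (Fin n → ℂ) → ℝ) := by
  unfold sqNorm
  fun_prop

theorem differentiable_hermForm (w : Fin n → ℂ) : Differentiable ℂ (hermForm w) := by
  unfold hermForm
  fun_prop

theorem sqNorm_smul (c : ℂ) (z : Fin n → ℂ) : sqNorm (c • z) = ‖c‖ ^ 2 * sqNorm z := by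
  simp [sqNorm, mul_pow, Finset.mul_sum]

theorem hermForm_self (z : Fin n → ℂ) : hermForm z z = sqNorm z := by
  simp [hermForm, sqNorm, Complex.conj_mul']

theorem hermForm_smul_left (c : ℂ) (w z : Fin n → ℂ) :
    hermForm (c • w) z = conj c * hermForm w z := by
  simp [hermForm, Finset.mul_sum, mul_assoc]

theorem hermForm_smul_right (c : ℂ) (w z : Fin n → ℂ) :
    hermForm w (c • z) = c * hermForm w z := by
  simp [hermForm, Finset.mul_sum, mul_left_comm]

theorem sqNorm_add (z w : Fin n → ℂ) :
    sqNorm (z + w) = sqNorm z + sqNorm w + 2 * (hermForm w z).re := by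
  simp only [sqNorm, hermForm, Complex.re_sum, Finset.mul_sum, ← Finset.sum_add_distrib]
  refine Finset.sum_congr rfl fun j _ => ?_
  simp only [Pi.add_apply, Complex.sq_norm, Complex.normSq_apply, Complex.add_re, Complex.add_im,
    Complex.mul_re, Complex.conj_re, Complex.conj_im]
  ring

theorem norm_sq_le_sqNorm (z : Fin n → ℂ) : ‖z‖ ^ 2 ≤ sqNorm z := by
  have h : ‖z‖ ≤ √(sqNorm z) := (pi_norm_le_iff_of_nonneg (Real.sqrt_nonneg _)).2 fun j =>
    Real.le_sqrt_of_sq_le (Finset.single_le_sum (f := fun j => ‖z j‖ ^ 2)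
      (fun _ _ => sq_nonneg _) (Finset.mem_univ j))
  calc ‖z‖ ^ 2 ≤ √(sqNorm z) ^ 2 := pow_le_pow_left₀ (norm_nonneg _) h 2
    _ = sqNorm z := Real.sq_sqrt (sqNorm_nonneg z)

theorem sqNorm_le_norm_sq (z : Fin n → ℂ) : sqNorm z ≤ n * ‖z‖ ^ 2 := by
  calc sqNorm z ≤ ∑ _j : Fin n, ‖z‖ ^ 2 :=
        Finset.sum_le_sum fun j _ => pow_le_pow_left₀ (norm_nonneg _) (norm_le_pi_norm z j) 2
    _ = n * ‖z‖ ^ 2 := by simp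

/-- The density of the Gaussian measure. -/
def fockWeight (α : ℝ) (z : Fin n → ℂ) : ℝ := (α / Real.pi) ^ n * Real.exp (-α * sqNorm z)

theorem continuous_fockWeight : Continuous (fockWeight α : (Fin n → ℂ) → ℝ) := by
  unfold fockWeight
  have := continuous_sqNorm (n := n)
  fun_prop

theorem fockMeasure_eq : fockMeasure n α =
    (volume : Measure (Fin n → ℂ)).withDensity fun z => ENNReal.ofReal (fockWeight α z) := rfl

theorem measurable_ofReal_fockWeight :
    Measurable fun z : Fin n → ℂ => ENNReal.ofReal (fockWeight α z) :=
  ENNReal.measurable_ofReal.comp continuous_fockWeight.measurable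

theorem measurePreserving_smul_fockMeasure {c : ℂ} (hc : ‖c‖ = 1) :
    MeasurePreserving (fun z : Fin n → ℂ => c • z) (fockMeasure n α) (fockMeasure n α) := by
  have hvol : MeasurePreserving (fun z : Fin n → ℂ => c • z) := by
    have h1 : MeasurePreserving (fun z : ℂ => c * z) := by
      have := (rotation ⟨c, by simpa [Submonoid.unitSphere] using hc⟩).measurePreserving
      exact this
    exact volume_preserving_pi fun _ : Fin n => h1
  refine ⟨hvol.measurable, Measure.ext fun s hs => ?_⟩
  rw [Measure.map_apply hvol.measurable hs, fockMeasure_eq,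
    withDensity_apply _ (hvol.measurable hs), withDensity_apply _ hs,
    ← lintegral_indicator (hvol.measurable hs), ← lintegral_indicator hs,
    ← hvol.lintegral_comp (measurable_ofReal_fockWeight.indicator hs)]
  refine lintegral_congr fun z => ?_
  have : fockWeight α (c • z) = fockWeight α z := by
    rw [fockWeight, fockWeight, sqNorm_smul, hc, one_pow, one_mul]
  by_cases hz : c • z ∈ s <;> simp [Set.indicator, hz, this]

variable [hα : Fact (0 < α)]

theorem fockWeight_pos (z : Fin n → ℂ) : 0 < fockWeight α z := by
  have := hα.out
  unfold fockWeight
  positivity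

theorem integrable_fockMeasure_iff {F : (Fin n → ℂ) → ℝ} :
    Integrable F (fockMeasure n α) ↔ Integrable (fun z => fockWeight α z * F z) := by
  rw [fockMeasure_eq, integrable_withDensity_iff_integrable_smul' measurable_ofReal_fockWeight
    (by simp)]
  simp_rw [ENNReal.toReal_ofReal (fockWeight_pos _).le, smul_eq_mul]

theorem integral_fockMeasure (F : (Fin n → ℂ) → ℝ) :
    ∫ z, F z ∂fockMeasure n α = ∫ z, fockWeight α z * F z := by
  rw [fockMeasure_eq, integral_withDensity_eq_integral_toReal_smul measurable_ofReal_fockWeight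
    (by simp)]
  simp_rw [ENNReal.toReal_ofReal (fockWeight_pos _).le, smul_eq_mul]

theorem integrable_exp_neg_mul_sqNorm {c : ℝ} (hc : 0 < c) :
    Integrable fun z : Fin n → ℂ => Real.exp (-c * sqNorm z) := by
  have h1 : Integrable fun z : ℂ => Real.exp (-c * ‖z‖ ^ 2) := by
    have := (GaussianFourier.integrable_cexp_neg_mul_sq_norm_add (V := ℂ) (b := (c : ℂ))
      (by simpa using hc) 0 0).norm
    refine this.congr (Filter.Eventually.of_forall fun z => ?_)
    simp only [Complex.norm_exp]
    congr 1
    simp [← Complex.ofReal_pow, ← Complex.ofReal_mul, ← Complex.ofReal_neg]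
  have h2 := Integrable.fintype_prod (f := fun (_ : Fin n) (z : ℂ) => Real.exp (-c * ‖z‖ ^ 2))
    (μ := fun _ => volume) fun _ => h1
  refine h2.congr (Filter.Eventually.of_forall fun z => ?_)
  simp only [← Real.exp_sum, sqNorm, Finset.mul_sum]

theorem integrable_exp_mul_sqNorm {c : ℝ} (hc : c < α) :
    Integrable (fun z : Fin n → ℂ => Real.exp (c * sqNorm z)) (fockMeasure n α) := by
  rw [integrable_fockMeasure_iff]
  refine ((integrable_exp_neg_mul_sqNorm (sub_pos.2 hc)).const_mul ((α / Real.pi) ^ n)).congr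
    (Filter.Eventually.of_forall fun z => ?_)
  simp only [fockWeight]
  rw [mul_assoc, ← Real.exp_add]
  ring_nf

instance : IsFiniteMeasure (fockMeasure n α) := by
  have h := integrable_exp_mul_sqNorm (n := n) (c := 0) hα.out
  simp only [zero_mul, Real.exp_zero] at h
  rcases (integrable_const_iff (μ := fockMeasure n α) (c := (1 : ℝ))).1 h with h | h
  · exact absurd h one_ne_zero
  · exact h

variable (n α) in
/-- The total mass of the Gaussian measure. -/
def fockMass : ℝ := (fockMeasure n α).real Set.univ

/-- The exact value of the mass plays no role; later estimates carry it as a constant. -/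
theorem fockMass_pos : 0 < fockMass n α := by
  have hac : (volume : Measure (Fin n → ℂ)) ≪ fockMeasure n α :=
    withDensity_absolutelyContinuous' measurable_ofReal_fockWeight.aemeasurable
      (Filter.Eventually.of_forall fun z => (ENNReal.ofReal_pos.2 (fockWeight_pos z)).ne')
  rw [fockMass, measureReal_def, ENNReal.toReal_pos_iff]
  exact ⟨pos_iff_ne_zero.2 fun h => NeZero.ne _ (Measure.measure_univ_eq_zero.1 (hac h)),
    measure_lt_top _ _⟩

/-- The mean value property of entire functions for the Gaussian measure. -/
theorem integral_fockMeasure_eq_mul_apply_zero {f : (Fin n → ℂ) → ℂ} (hf : Differentiable ℂ f)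
    (hi : Integrable f (fockMeasure n α)) :
    ∫ z, f z ∂fockMeasure n α = fockMass n α * f 0 := by
  set μ := fockMeasure n α
  -- Rotations preserve the measure, so the integral equals its average over θ. By Fubini the circle
  -- mean is taken first, and on the complex line through z it is 2π f(0).
  set e : ℝ → ℂ := circleMap 0 1 with he
  have hnorm : ∀ θ, ‖e θ‖ = 1 := fun θ => by simp [he]
  have hpres : ∀ θ, MeasurePreserving (fun z : Fin n → ℂ => e θ • z) μ μ := fun θ =>
    measurePreserving_smul_fockMeasure (hnorm θ)
  have hemb : ∀ θ, MeasurableEmbedding (fun z : Fin n → ℂ => e θ • z) := fun θ =>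
    (Homeomorph.smulOfNeZero (e θ) (by
      intro h
      simpa [h] using hnorm θ)).measurableEmbedding
  have hcont : Continuous fun q : ℝ × (Fin n → ℂ) => f (e q.1 • q.2) :=
    hf.continuous.comp (((continuous_circleMap 0 1).comp continuous_fst).smul continuous_snd)
  have hint : Integrable (Function.uncurry fun (θ : ℝ) (z : Fin n → ℂ) => f (e θ • z))
      ((volume.restrict (Set.uIoc 0 (2 * Real.pi))).prod μ) := by
    refine (integrable_prod_iff hcont.aestronglyMeasurable).2 ⟨Filter.Eventually.of_forall fun θ =>
      ((hpres θ).integrable_comp_emb (hemb θ)).2 hi, ?_⟩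
    have : ∀ θ, ∫ z, ‖f (e θ • z)‖ ∂μ = ∫ z, ‖f z‖ ∂μ := fun θ =>
      (hpres θ).integral_comp (hemb θ) fun z => ‖f z‖
    simp only [this]
    have : IsFiniteMeasure (volume.restrict (Set.uIoc 0 (2 * Real.pi))) := by
      rw [Set.uIoc]
      infer_instance
    exact integrable_const _
  have hmean : ∀ z, ∫ θ in (0 : ℝ)..2 * Real.pi, f (e θ • z) = (2 * Real.pi : ℝ) • f 0 := by
    intro z
    have hd : Differentiable ℂ fun t : ℂ => f (t • z) :=
      hf.comp (differentiable_id.smul_const z)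
    have h := DiffContOnCl.circleAverage (f := fun t : ℂ => f (t • z)) (c := 0) (R := 1)
      hd.diffContOnCl
    rw [Real.circleAverage_def, zero_smul, inv_smul_eq_iff₀ (by positivity)] at h
    exact h
  have h1 : ∫ θ in (0 : ℝ)..2 * Real.pi, ∫ z, f (e θ • z) ∂μ =
      ∫ z, (∫ θ in (0 : ℝ)..2 * Real.pi, f (e θ • z)) ∂μ :=
    intervalIntegral_integral_swap hint
  have h2 : ∀ θ, ∫ z, f (e θ • z) ∂μ = ∫ z, f z ∂μ := fun θ =>
    (hpres θ).integral_comp (hemb θ) f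
  simp only [h2, hmean, intervalIntegral.integral_const, integral_const, sub_zero] at h1
  rw [smul_comm] at h1
  have h3 := smul_right_injective ℂ (r := 2 * Real.pi) (by positivity) h1
  rw [h3, fockMass, Complex.real_smul]

end Gaussian

/-! ### Weyl translates, point evaluations and reproducing kernels. -/

namespace FockSpace

variable {n : ℕ} {α : ℝ}

theorem coe_sub (f g : FockSpace n α) (z : Fin n → ℂ) : (f - g) z = f z - g z := rfl

theorem coe_smul (c : ℂ) (f : FockSpace n α) (z : Fin n → ℂ) : (c • f) z = c * f z := rfl

variable (α) in
/-- Evaluation at a point, as a linear functional. -/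
def evalₗ (z : Fin n → ℂ) : FockSpace n α →ₗ[ℂ] ℂ where
  toFun f := f z
  map_add' _ _ := rfl
  map_smul' _ _ := rfl

theorem coe_sum {ι : Type*} (s : Finset ι) (f : ι → FockSpace n α) (z : Fin n → ℂ) :
    (∑ i ∈ s, f i : FockSpace n α) z = ∑ i ∈ s, f i z :=
  map_sum (evalₗ α z) f s

/-- The exponential factor relating the Gaussian density to its translates. -/
theorem fockWeight_mul_norm_exp_sq (z w : Fin n → ℂ) :
    fockWeight α z * ‖Complex.exp (-α * hermForm w z)‖ ^ 2 =
      Real.exp (α * sqNorm w) * fockWeight α (z + w) := by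
  have : (-(α : ℂ) * hermForm w z).re = -α * (hermForm w z).re := by
    rw [← Complex.ofReal_neg, Complex.re_ofReal_mul]
  rw [Complex.norm_exp, this, ← Real.exp_nat_mul, fockWeight, fockWeight, sqNorm_add, mul_assoc,
    ← Real.exp_add, mul_left_comm (Real.exp (α * sqNorm w)), ← Real.exp_add]
  congr 2
  push_cast
  ring

variable [hα : Fact (0 < α)]

theorem mem_fockSubmodule_iff {f : (Fin n → ℂ) → ℂ} : f ∈ fockSubmodule n α ↔
    Differentiable ℂ f ∧ Integrable fun z => fockWeight α z * ‖f z‖ ^ 2 := by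
  refine and_congr_right fun hf => ?_
  rw [memLp_two_iff_integrable_sq_norm hf.continuous.aestronglyMeasurable,
    integrable_fockMeasure_iff]

theorem norm_sq_eq (f : FockSpace n α) : ‖f‖ ^ 2 = ∫ z, ‖f z‖ ^ 2 ∂fockMeasure n α := by
  have h : ((‖f‖ ^ 2 : ℝ) : ℂ) = inner ℂ f f := by
    rw [inner_self_eq_norm_sq_to_K]
    norm_cast
  rw [inner_self] at h
  exact_mod_cast h

theorem norm_sq_eq_integral_weight (f : FockSpace n α) :
    ‖f‖ ^ 2 = ∫ z, fockWeight α z * ‖f z‖ ^ 2 := by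
  rw [norm_sq_eq, integral_fockMeasure]

/-- The Weyl translate of a function in the Fock space, up to normalization. -/
def translate (w : Fin n → ℂ) (f : FockSpace n α) : FockSpace n α :=
  ⟨fun z => f (z + w) * Complex.exp (-α * hermForm w z), by
    obtain ⟨hf1, hf2⟩ := mem_fockSubmodule_iff.1 f.mem
    refine mem_fockSubmodule_iff.2 ⟨?_, ?_⟩
    · have := differentiable_hermForm w
      exact (hf1.comp (differentiable_id.add_const w)).mul
        ((this.const_mul (-(α : ℂ))).cexp)
    · have h := (hf2.comp_add_right w).const_mul (Real.exp (α * sqNorm w))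
      refine h.congr (Filter.Eventually.of_forall fun z => ?_)
      simp only
      rw [norm_mul, mul_pow]
      linear_combination (-‖f (z + w)‖ ^ 2) * fockWeight_mul_norm_exp_sq (α := α) z w⟩

theorem translate_apply (w z : Fin n → ℂ) (f : FockSpace n α) :
    translate w f z = f (z + w) * Complex.exp (-α * hermForm w z) := rfl

theorem norm_sq_translate (w : Fin n → ℂ) (f : FockSpace n α) :
    ‖translate w f‖ ^ 2 = Real.exp (α * sqNorm w) * ‖f‖ ^ 2 := by
  rw [norm_sq_eq_integral_weight, norm_sq_eq_integral_weight,
    ← integral_add_right_eq_self (fun z => fockWeight α z * ‖f z‖ ^ 2) w, ← integral_const_mul]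
  congr 1
  ext z
  rw [translate_apply, norm_mul, mul_pow]
  linear_combination ‖f (z + w)‖ ^ 2 * fockWeight_mul_norm_exp_sq (α := α) z w

/-- The constant function `1`. -/
def one : FockSpace n α := ⟨fun _ => 1, differentiable_const 1, memLp_const 1⟩

theorem norm_sq_one : ‖(one : FockSpace n α)‖ ^ 2 = fockMass n α := by
  rw [norm_sq_eq, one]
  simp [fockMass]

theorem fockMass_mul_apply_zero (f : FockSpace n α) : fockMass n α * f 0 = inner ℂ one f := by
  rw [← integral_fockMeasure_eq_mul_apply_zero f.mem.1 (f.memLp.integrable one_le_two), inner_def]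
  simp [one]

/-- Point evaluations are bounded on the Fock space. -/
theorem norm_apply_sq_le (f : FockSpace n α) (w : Fin n → ℂ) :
    ‖f w‖ ^ 2 ≤ (fockMass n α)⁻¹ * Real.exp (α * sqNorm w) * ‖f‖ ^ 2 := by
  have hm := fockMass_pos (n := n) (α := α)
  have h0 : translate w f 0 = f w := by simp [translate_apply, hermForm]
  -- The value at w is the value at 0 of a translate, hence up to the mass an inner product with the
  -- constant 1.
  have h1 : fockMass n α * ‖f w‖ ≤ ‖(one : FockSpace n α)‖ * ‖translate w f‖ := by
    have h := norm_inner_le_norm (𝕜 := ℂ) one (translate w f)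
    rwa [← fockMass_mul_apply_zero, h0, norm_mul, Complex.norm_real, Real.norm_of_nonneg hm.le] at h
  have h2 := pow_le_pow_left₀ (by positivity) h1 2
  rw [mul_pow, mul_pow, norm_sq_one, norm_sq_translate, pow_two (fockMass n α), mul_assoc] at h2
  have h3 := le_of_mul_le_mul_left h2 hm
  rw [mul_assoc]
  exact (le_inv_mul_iff₀ hm).2 h3

/-- The sum of the squares of the values of an orthonormal system is bounded by the diagonal of the
reproducing kernel. -/
theorem sum_norm_apply_sq_le {m : ℕ} {e : Fin m → FockSpace n α} (he : Orthonormal ℂ e)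
    (w : Fin n → ℂ) : ∑ i, ‖e i w‖ ^ 2 ≤ (fockMass n α)⁻¹ * Real.exp (α * sqNorm w) := by
  set S := ∑ i, ‖e i w‖ ^ 2 with hS
  have hS0 : 0 ≤ S := Finset.sum_nonneg fun _ _ => sq_nonneg _
  -- This is the extremal test function: f(w) = S = ‖f‖², so the point evaluation bound reads S² ≤ K
  -- S.
  set f : FockSpace n α := ∑ i, conj (e i w) • e i with hf
  have hnorm : ‖f‖ ^ 2 = S := by
    rw [hf, norm_sq_sum_of_pairwise_orthogonal he.2]
    simp [he.1, hS]
  have hval : f w = (S : ℂ) := by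
    rw [hf, coe_sum, hS, Complex.ofReal_sum]
    refine Finset.sum_congr rfl fun i _ => ?_
    rw [coe_smul, Complex.conj_mul', Complex.ofReal_pow]
  have h := norm_apply_sq_le f w
  rw [hnorm, hval, Complex.norm_real, Real.norm_of_nonneg hS0, pow_two] at h
  rcases hS0.eq_or_lt with h0 | h0
  · rw [← h0]
    have := fockMass_pos (n := n) (α := α)
    positivity
  · exact le_of_mul_le_mul_right h h0

variable (α) in
/-- The reproducing kernel at `v`, up to normalization. -/
def kernel (v : Fin n → ℂ) : FockSpace n α := translate (-v) one

theorem kernel_apply (v z : Fin n → ℂ) : kernel α v z = Complex.exp (α * hermForm v z) := by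
  rw [kernel, translate_apply]
  simp [one, hermForm]

theorem norm_sq_kernel (v : Fin n → ℂ) :
    ‖kernel α v‖ ^ 2 = Real.exp (α * sqNorm v) * fockMass n α := by
  rw [kernel, norm_sq_translate, norm_sq_one]
  simp [sqNorm]

end FockSpace

/-! ### Composition with asymptotic contractions. -/

section Contractive

variable {n : ℕ} {α : ℝ}

/-- An entire self-map of `ℂⁿ` that is, up to a bounded error, a strict contraction. -/
structure IsAsymptoticContraction (χ : (Fin n → ℂ) → (Fin n → ℂ)) : Prop where
  differentiable : Differentiable ℂ χ
  exists_bound : ∃ τ C : ℝ, 0 ≤ τ ∧ τ < 1 ∧ ∀ z, sqNorm (χ z) ≤ τ * sqNorm z + C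

variable [hα : Fact (0 < α)]

namespace IsAsymptoticContraction

variable {χ : (Fin n → ℂ) → (Fin n → ℂ)}

/-- Since τ < 1, exp(ατ|z|²) is still integrable against the Gaussian weight. -/
theorem exists_integrable_bound (hχ : IsAsymptoticContraction χ) :
    ∃ G : (Fin n → ℂ) → ℝ, Integrable G (fockMeasure n α) ∧
      ∀ z, (fockMass n α)⁻¹ * Real.exp (α * sqNorm (χ z)) ≤ G z := by
  obtain ⟨τ, C, -, hτ, h⟩ := hχ.exists_bound
  have hα0 := hα.out
  have hm := fockMass_pos (n := n) (α := α)
  refine ⟨fun z => (fockMass n α)⁻¹ * Real.exp (α * C) * Real.exp (α * τ * sqNorm z),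
    (integrable_exp_mul_sqNorm (by nlinarith)).const_mul _, fun z => ?_⟩
  beta_reduce
  rw [mul_assoc, ← Real.exp_add]
  refine mul_le_mul_of_nonneg_left (Real.exp_le_exp.2 ?_) (by positivity)
  nlinarith [h z]

theorem comp_mem (hχ : IsAsymptoticContraction χ) (f : FockSpace n α) :
    (f : (Fin n → ℂ) → ℂ) ∘ χ ∈ fockSubmodule n α := by
  have hd : Differentiable ℂ ((f : (Fin n → ℂ) → ℂ) ∘ χ) := f.mem.1.comp hχ.differentiable
  obtain ⟨G, hG, hle⟩ := hχ.exists_integrable_bound (α := α)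
  refine ⟨hd, (memLp_two_iff_integrable_sq_norm hd.continuous.aestronglyMeasurable).2 ?_⟩
  refine (hG.mul_const (‖f‖ ^ 2)).mono' (hd.continuous.norm.pow 2).aestronglyMeasurable
    (Filter.Eventually.of_forall fun z => ?_)
  rw [Real.norm_of_nonneg (sq_nonneg _)]
  exact (f.norm_apply_sq_le (χ z)).trans (mul_le_mul_of_nonneg_right (hle z) (sq_nonneg _))

variable (α) in
/-- The composition operator with an asymptotic contraction. -/
def compOp (hχ : IsAsymptoticContraction χ) : FockSpace n α →ₗ[ℂ] FockSpace n α :=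
  compositionOperator χ hχ.comp_mem

/-- Exchanging sum and integral bounds the left side by the integral of the kernel diagonal at χ(z),
uniformly in the system. -/
theorem exists_sum_norm_sq_le (hχ : IsAsymptoticContraction χ) :
    ∃ M : ℝ, 0 ≤ M ∧ ∀ (m : ℕ) (e : Fin m → FockSpace n α), Orthonormal ℂ e →
      ∑ i, ‖hχ.compOp α (e i)‖ ^ 2 ≤ M := by
  obtain ⟨G, hG, hle⟩ := hχ.exists_integrable_bound (α := α)
  have hm := fockMass_pos (n := n) (α := α)
  refine ⟨∫ z, G z ∂fockMeasure n α,
    integral_nonneg fun z => le_trans (by positivity) (hle z), fun m e he => ?_⟩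
  have hint : ∀ i, Integrable (fun z => ‖hχ.compOp α (e i) z‖ ^ 2) (fockMeasure n α) := fun i =>
    (memLp_two_iff_integrable_sq_norm (hχ.compOp α (e i)).memLp.1).1 (hχ.compOp α (e i)).memLp
  simp_rw [FockSpace.norm_sq_eq]
  rw [← integral_finsetSum _ fun i _ => hint i]
  exact integral_mono (integrable_finsetSum _ fun i _ => hint i) hG fun z =>
    (FockSpace.sum_norm_apply_sq_le he (χ z)).trans (hle z)

theorem exists_factorization (hχ : IsAsymptoticContraction χ) :
    ∃ (ψ δ : (Fin n → ℂ) → (Fin n → ℂ)) (hψ : IsAsymptoticContraction ψ)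
      (hδ : IsAsymptoticContraction δ), hχ.compOp α = hψ.compOp α ∘ₗ hδ.compOp α := by
  obtain ⟨τ, C, hτ0, hτ, h⟩ := hχ.exists_bound
  -- With χ = δ ∘ ψ and δ the dilation by √ρ, the constants are ρ for δ and τ / ρ for ψ; both are
  -- below 1 exactly because τ < ρ < 1.
  obtain ⟨ρ, hρ1, hρ2⟩ := exists_between hτ
  have hρ0 : 0 < ρ := hτ0.trans_lt hρ1
  set σ : ℝ := √ρ with hσ
  have hσ2 : σ ^ 2 = ρ := Real.sq_sqrt hρ0.le
  have hσ0 : (σ : ℂ) ≠ 0 := Complex.ofReal_ne_zero.2 (Real.sqrt_pos.2 hρ0).ne'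
  refine ⟨fun z => (σ : ℂ)⁻¹ • χ z, fun z => (σ : ℂ) • z,
    ⟨hχ.differentiable.fun_const_smul _, τ / ρ, C / ρ, by positivity, (div_lt_one hρ0).2 hρ1,
      fun z => ?_⟩, ⟨by fun_prop, ρ, 0, hρ0.le, hρ2, fun z => ?_⟩, ?_⟩
  · rw [sqNorm_smul, norm_inv, Complex.norm_real, inv_pow, Real.norm_eq_abs, sq_abs, hσ2,
      inv_mul_le_iff₀ hρ0]
    refine (h z).trans (le_of_eq ?_)
    field_simp
  · rw [sqNorm_smul, Complex.norm_real, Real.norm_eq_abs, sq_abs, hσ2, add_zero]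
  · refine LinearMap.ext fun f => Subtype.ext (funext fun z => ?_)
    change f (χ z) = f ((σ : ℂ) • (σ : ℂ)⁻¹ • χ z)
    rw [smul_inv_smul₀ hσ0]

/-- The Gelfand numbers of composition with an asymptotic contraction decay faster than any
negative power, because such operators factor into arbitrarily many Hilbert–Schmidt operators. -/
theorem gelfandDecay (m : ℕ) (hχ : IsAsymptoticContraction χ) :
    GelfandDecay (hχ.compOp α) m := by
  induction m generalizing χ with
  | zero =>
    obtain ⟨M, hM, h⟩ := hχ.exists_sum_norm_sq_le (α := α)
    refine ⟨√(M / ((0 : ℕ) + 1)), Real.sqrt_nonneg _, fun k => ?_⟩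
    rw [zero_mul, pow_zero, div_one]
    -- Decay of order 0 is plain boundedness, the Hilbert–Schmidt bound at index 0.
    exact gelfandBound_of_sum_sq_le hM h 0
  | succ m ih =>
    obtain ⟨ψ, δ, hψ, hδ, hfac⟩ := hχ.exists_factorization (α := α)
    obtain ⟨M, hM, h⟩ := ih hψ
    obtain ⟨M', hM', h'⟩ := hδ.exists_sum_norm_sq_le (α := α)
    refine ⟨M * √M', by positivity, fun k => ?_⟩
    have := (h k).comp (by positivity) (gelfandBound_of_sum_sq_le hM' h' k)
    rw [hfac, add_mul, one_mul, pow_succ, mul_div_mul_comm, ← Real.sqrt_div hM']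
    exact this

end IsAsymptoticContraction

end Contractive

/-! ### Completeness of the Fock space. -/

namespace FockSpace

variable {n : ℕ} {α : ℝ}

theorem fderiv_sub (f g : FockSpace n α) (z : Fin n → ℂ) :
    fderiv ℂ (f - g : FockSpace n α) z = fderiv ℂ f z - fderiv ℂ g z :=
  _root_.fderiv_sub (f.mem.1 z) (g.mem.1 z)

variable [hα : Fact (0 < α)]

theorem eLpNorm_eq (f : FockSpace n α) :
    eLpNorm (f : (Fin n → ℂ) → ℂ) 2 (fockMeasure n α) = ENNReal.ofReal ‖f‖ := by
  rw [f.memLp.eLpNorm_eq_integral_rpow_norm two_ne_zero ENNReal.ofNat_ne_top]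
  congr 1
  have : ∫ z, ‖f z‖ ^ (2 : ENNReal).toReal ∂fockMeasure n α = ‖f‖ ^ 2 := by
    rw [norm_sq_eq]
    simp
  rw [this]
  simpa [Real.sqrt_eq_rpow] using Real.sqrt_sq (norm_nonneg f)

variable (n α) in
theorem exists_norm_apply_le (R : ℝ) : ∃ B : ℝ, 0 ≤ B ∧ ∀ (f : FockSpace n α) (z : Fin n → ℂ),
    ‖z‖ ≤ R → ‖f z‖ ≤ B * ‖f‖ := by
  have hα0 := hα.out
  have hm := fockMass_pos (n := n) (α := α)
  refine ⟨√((fockMass n α)⁻¹ * Real.exp (α * (n * R ^ 2))), Real.sqrt_nonneg _,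
    fun f z hz => ?_⟩
  refine le_of_sq_le_sq ?_ (by positivity)
  rw [mul_pow, Real.sq_sqrt (by positivity)]
  refine (f.norm_apply_sq_le z).trans ?_
  have h1 : sqNorm z ≤ n * R ^ 2 := (sqNorm_le_norm_sq z).trans (by gcongr)
  gcongr

-- Cauchy's estimate on unit circles in complex lines reduces this to the bound on values over a
-- ball of radius R + 1.
variable (n α) in
theorem exists_norm_fderiv_le (R : ℝ) : ∃ B : ℝ, 0 ≤ B ∧ ∀ (f : FockSpace n α) (z : Fin n → ℂ),
    ‖z‖ ≤ R → ‖fderiv ℂ f z‖ ≤ B * ‖f‖ := by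
  obtain ⟨B, hB, h⟩ := exists_norm_apply_le n α (R + 1)
  refine ⟨B, hB, fun f z hz => ContinuousLinearMap.opNorm_le_of_unit_norm (𝕜 := ℂ)
    (by positivity) fun v hv => ?_⟩
  have hd : Differentiable ℂ fun t : ℂ => f (z + t • v) :=
    f.mem.1.comp ((differentiable_id.smul_const v).const_add z)
  have hderiv : deriv (fun t : ℂ => f (z + t • v)) 0 = fderiv ℂ f z v :=
    (f.mem.1 z).lineDeriv_eq_fderiv
  have hC := Complex.norm_deriv_le_of_forall_mem_sphere_norm_le (c := 0) (R := 1)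
    (C := B * ‖f‖) one_pos hd.diffContOnCl fun t ht => h f _ ?_
  · rwa [hderiv, div_one] at hC
  · refine (norm_add_le _ _).trans (add_le_add hz ?_)
    rw [norm_smul, hv, mul_one, mem_sphere_zero_iff_norm.1 ht]

-- Values and derivatives of a Cauchy sequence converge locally uniformly, so the limit is entire;
-- Fatou's lemma upgrades this to norm convergence.
open Filter Topology in
instance : CompleteSpace (FockSpace n α) := by
  refine Metric.complete_of_cauchySeq_tendsto fun u hu => ?_
  rw [Metric.cauchySeq_iff] at hu
  have hcs : ∀ R : ℝ, UniformCauchySeqOn (fun k => fderiv ℂ (u k)) atTop (Metric.ball 0 R) ∧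
      UniformCauchySeqOn (fun k => (u k : (Fin n → ℂ) → ℂ)) atTop (Metric.ball 0 R) := by
    intro R
    obtain ⟨B, hB, h⟩ := exists_norm_apply_le n α R
    obtain ⟨B', hB', h'⟩ := exists_norm_fderiv_le n α R
    constructor <;> rw [Metric.uniformCauchySeqOn_iff] <;> intro ε hε
    · obtain ⟨N, hN⟩ := hu (ε / (B' + 1)) (by positivity)
      refine ⟨N, fun k hk l hl z hz => ?_⟩
      rw [dist_eq_norm, ← fderiv_sub]
      have h1 := h' (u k - u l) z (mem_ball_zero_iff.1 hz).le
      have h2 := hN k hk l hl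
      rw [dist_eq_norm, lt_div_iff₀ (by positivity)] at h2
      nlinarith [norm_nonneg (u k - u l)]
    · obtain ⟨N, hN⟩ := hu (ε / (B + 1)) (by positivity)
      refine ⟨N, fun k hk l hl z hz => ?_⟩
      rw [dist_eq_norm, ← coe_sub]
      have h1 := h (u k - u l) z (mem_ball_zero_iff.1 hz).le
      have h2 := hN k hk l hl
      rw [dist_eq_norm, lt_div_iff₀ (by positivity)] at h2
      nlinarith [norm_nonneg (u k - u l)]
  have hmem : ∀ z : Fin n → ℂ, z ∈ Metric.ball (0 : Fin n → ℂ) (‖z‖ + 1) := fun z => by simp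
  choose g' hg' using fun z => cauchySeq_tendsto_of_complete ((hcs (‖z‖ + 1)).1.cauchySeq (hmem z))
  choose g hg using fun z => cauchySeq_tendsto_of_complete ((hcs (‖z‖ + 1)).2.cauchySeq (hmem z))
  have hgd : Differentiable ℂ g := fun z =>
    (hasFDerivAt_of_tendstoLocallyUniformlyOn Metric.isOpen_ball
      ((hcs (‖z‖ + 1)).1.tendstoUniformlyOn_of_tendsto fun x _ => hg' x).tendstoLocallyUniformlyOn
      (fun k x _ => ((u k).mem.1 x).hasFDerivAt) (fun x _ => hg x) (hmem z)).differentiableAt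
  have hfatou : ∀ ε > 0, ∃ N, ∀ k ≥ N, eLpNorm (fun z => u k z - g z) 2 (fockMeasure n α) ≤
      ENNReal.ofReal ε := by
    intro ε hε
    obtain ⟨N, hN⟩ := hu ε hε
    refine ⟨N, fun k hk => ?_⟩
    have h1 := Lp.eLpNorm_lim_le_liminf_eLpNorm (p := 2) (μ := fockMeasure n α)
      (f := fun l => ((u k - u l : FockSpace n α) : (Fin n → ℂ) → ℂ)) (fun l => (memLp _).1)
      (fun z => u k z - g z) (Eventually.of_forall fun z => (hg z).const_sub (u k z))
    refine h1.trans (liminf_le_of_frequently_le' (Eventually.frequently ?_))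
    filter_upwards [eventually_ge_atTop N] with l hl
    rw [eLpNorm_eq]
    exact ENNReal.ofReal_le_ofReal (by simpa [dist_eq_norm] using (hN k hk l hl).le)
  have hgm : MemLp g 2 (fockMeasure n α) := by
    obtain ⟨N, hN⟩ := hfatou 1 one_pos
    have h1 : MemLp (fun z => u N z - g z) 2 (fockMeasure n α) :=
      ⟨((u N).mem.1.continuous.sub hgd.continuous).aestronglyMeasurable,
        (hN N le_rfl).trans_lt ENNReal.ofReal_lt_top⟩
    have h2 := (u N).memLp.sub h1
    refine h2.congr_norm hgd.continuous.aestronglyMeasurable (Eventually.of_forall fun z => ?_)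
    simp
  refine ⟨(⟨g, hgd, hgm⟩ : fockSubmodule n α), Metric.tendsto_atTop.2 fun ε hε => ?_⟩
  obtain ⟨N, hN⟩ := hfatou (ε / 2) (half_pos hε)
  refine ⟨N, fun k hk => ?_⟩
  have h1 := hN k hk
  set G : FockSpace n α := (⟨g, hgd, hgm⟩ : fockSubmodule n α)
  have h2 : eLpNorm (fun z => u k z - g z) 2 (fockMeasure n α) = ENNReal.ofReal ‖u k - G‖ :=
    eLpNorm_eq (u k - G)
  rw [h2, ENNReal.ofReal_le_ofReal_iff (half_pos hε).le] at h1
  rw [dist_eq_norm]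
  linarith

end FockSpace

/-! ### The symbol is affine with strictly contractive linear part. -/

/-- An entire function of linear growth is affine. -/
theorem eq_add_deriv_of_linear_growth {F : Type*} [NormedAddCommGroup F] [NormedSpace ℂ F]
    [CompleteSpace F] {g : ℂ → F} (hg : Differentiable ℂ g) {a b : ℝ} (ha : 0 ≤ a) (hb : 0 ≤ b)
    (h : ∀ t, ‖g t‖ ≤ a * ‖t‖ + b) (t : ℂ) : g t = g 0 + t • deriv g 0 := by
  have hbd : ∀ t, ‖deriv g t‖ ≤ 2 * a + b := by
    intro t
    -- A Cauchy radius growing with t cancels the linear growth; Liouville then applies to the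
    -- derivative.
    have hR : 0 < 1 + ‖t‖ := by positivity
    refine (Complex.norm_deriv_le_of_forall_mem_sphere_norm_le (C := (2 * a + b) * (1 + ‖t‖)) hR
      hg.diffContOnCl fun s hs => (h s).trans ?_).trans_eq (mul_div_cancel_right₀ _ hR.ne')
    have h1 : ‖s‖ ≤ 1 + 2 * ‖t‖ := by
      have := norm_add_le (s - t) t
      rw [sub_add_cancel, mem_sphere_iff_norm.1 hs] at this
      linarith
    nlinarith [mul_le_mul_of_nonneg_left h1 ha, mul_nonneg hb (norm_nonneg t)]
  have hconst : ∀ t, deriv g t = deriv g 0 := fun t =>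
    hg.deriv.apply_eq_apply_of_bounded
      ((isBounded_iff_forall_norm_le).2 ⟨_, Set.forall_mem_range.2 hbd⟩) t 0
  have hd : Differentiable ℂ fun s => g s - s • deriv g 0 :=
    hg.sub (differentiable_id.smul_const _)
  have h0 := is_const_of_deriv_eq_zero hd (fun s => by
    have := ((hg s).hasDerivAt.sub ((hasDerivAt_id s).smul_const (deriv g 0))).deriv
    rw [one_smul, hconst s, sub_self] at this
    exact this) t 0
  simp only [zero_smul, sub_zero] at h0
  rw [← h0, sub_add_cancel]

section Symbol

variable {n : ℕ} {α : ℝ}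

/-- Young's inequality, from |εz - w|² ≥ 0. -/
theorem sqNorm_add_le {ε : ℝ} (hε : 0 < ε) (z w : Fin n → ℂ) :
    sqNorm (z + w) ≤ (1 + ε) * sqNorm z + (1 + ε⁻¹) * sqNorm w := by
  have h1 := sqNorm_nonneg ((ε : ℂ) • z + (-1 : ℂ) • w)
  rw [sqNorm_add, sqNorm_smul, sqNorm_smul, hermForm_smul_left, hermForm_smul_right, norm_neg,
    norm_one, Complex.norm_real, Real.norm_eq_abs, sq_abs, map_neg, map_one, neg_one_mul,
    Complex.neg_re, Complex.re_ofReal_mul] at h1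
  have h2 : 2 * (hermForm w z).re ≤ ε * sqNorm z + ε⁻¹ * sqNorm w := by
    have := mul_le_mul_of_nonneg_left (sub_nonneg.1 (by linarith : 0 ≤
      (ε ^ 2 * sqNorm z + sqNorm w) - ε * (2 * (hermForm w z).re))) (inv_pos.2 hε).le
    rw [inv_mul_cancel_left₀ hε.ne'] at this
    refine this.trans_eq ?_
    field_simp
  rw [sqNorm_add]
  linarith

/-- An affine map whose linear part strictly decreases the Euclidean norm is an asymptotic
contraction. -/
theorem isAsymptoticContraction_of_affine (L : (Fin n → ℂ) →L[ℂ] (Fin n → ℂ))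
    (hL : ∀ z, z ≠ 0 → sqNorm (L z) < sqNorm z) (b : Fin n → ℂ) :
    IsAsymptoticContraction fun z => L z + b := by
  have hpos : ∀ z : Fin n → ℂ, z ≠ 0 → 0 < sqNorm z := fun z hz =>
    (by have := norm_pos_iff.2 hz; positivity : 0 < ‖z‖ ^ 2).trans_le (norm_sq_le_sqNorm z)
  obtain ⟨τ, hτ0, hτ1, hτ⟩ : ∃ τ : ℝ, 0 ≤ τ ∧ τ < 1 ∧ ∀ z, sqNorm (L z) ≤ τ * sqNorm z := by
    rcases isEmpty_or_nonempty (Fin n) with hn | hn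
    · exact ⟨0, le_rfl, one_pos, fun z => by simp [sqNorm]⟩
    obtain ⟨x, hx, hmax⟩ := (isCompact_sphere (0 : Fin n → ℂ) 1).exists_isMaxOn
      (f := fun z => sqNorm (L z) / sqNorm z) (NormedSpace.sphere_nonempty.2 zero_le_one)
      ((continuous_sqNorm.comp L.continuous).continuousOn.div continuous_sqNorm.continuousOn
        fun z hz => (hpos z (ne_zero_of_mem_unit_sphere ⟨z, hz⟩)).ne')
    have hx0 : x ≠ 0 := ne_zero_of_mem_unit_sphere ⟨x, hx⟩
    refine ⟨sqNorm (L x) / sqNorm x, div_nonneg (sqNorm_nonneg _) (sqNorm_nonneg _),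
      (div_lt_one (hpos x hx0)).2 (hL x hx0), fun z => ?_⟩
    rcases eq_or_ne z 0 with rfl | hz
    · simp [sqNorm]
    have hz0 : (‖z‖ : ℂ) ≠ 0 := Complex.ofReal_ne_zero.2 (norm_ne_zero_iff.2 hz)
    have h1 : sqNorm (L ((‖z‖ : ℂ)⁻¹ • z)) / sqNorm ((‖z‖ : ℂ)⁻¹ • z) ≤ _ :=
      hmax (by simp [norm_smul, norm_ne_zero_iff.2 hz] : (‖z‖ : ℂ)⁻¹ • z ∈ Metric.sphere 0 1)
    have h2 : ‖(‖z‖ : ℂ)⁻¹‖ ^ 2 ≠ 0 := by simpa using hz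
    rw [map_smul, sqNorm_smul, sqNorm_smul, mul_div_mul_left _ _ h2] at h1
    exact (div_le_iff₀ (hpos z hz)).1 h1
  -- Small enough that (1 + ε)τ < 1, which leaves room to absorb the translation `b`.
  set ε := (1 - τ) / 2 with hε
  have hε0 : 0 < ε := by linarith
  refine ⟨L.differentiable.add_const b, (1 + ε) * τ, (1 + ε⁻¹) * sqNorm b, by positivity,
    by nlinarith, fun z => (sqNorm_add_le hε0 _ _).trans ?_⟩
  nlinarith [mul_le_mul_of_nonneg_left (hτ z) (by positivity : 0 ≤ 1 + ε)]

variable [hα : Fact (0 < α)] {φ : (Fin n → ℂ) → (Fin n → ℂ)}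
  {hmaps : ∀ f : FockSpace n α, (f : (Fin n → ℂ) → ℂ) ∘ φ ∈ fockSubmodule n α}

/-- The point evaluation bound at w is applied to the image of the kernel at φ(w), whose value there
is exp(α|φ(w)|²). It serves both the boundedness and the compactness argument. -/
theorem norm_sq_kernel_mul_exp_le (w : Fin n → ℂ) :
    ‖FockSpace.kernel α (φ w)‖ ^ 2 * Real.exp (α * sqNorm (φ w)) ≤
      Real.exp (α * sqNorm w) * ‖compositionOperator φ hmaps (FockSpace.kernel α (φ w))‖ ^ 2 := by
  have hm := fockMass_pos (n := n) (α := α)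
  have h := FockSpace.norm_apply_sq_le (compositionOperator φ hmaps (FockSpace.kernel α (φ w))) w
  have h1 : ‖compositionOperator φ hmaps (FockSpace.kernel α (φ w)) w‖ =
      Real.exp (α * sqNorm (φ w)) := by
    change ‖FockSpace.kernel α (φ w) (φ w)‖ = _
    rw [FockSpace.kernel_apply, hermForm_self, ← Complex.ofReal_mul, Complex.norm_exp_ofReal]
  rw [h1, mul_assoc, le_inv_mul_iff₀ hm] at h
  rw [FockSpace.norm_sq_kernel]
  refine le_trans (le_of_eq ?_) h
  ring

/-- The symbol of a bounded composition operator does not increase the Euclidean norm by more than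
a constant. -/
theorem exists_sqNorm_symbol_le (hcont : Continuous (compositionOperator φ hmaps)) :
    ∃ C : ℝ, 0 ≤ C ∧ ∀ w, sqNorm (φ w) ≤ sqNorm w + C := by
  have hα0 := hα.out
  obtain ⟨M, hM, hle⟩ := (⟨compositionOperator φ hmaps, hcont⟩ :
    FockSpace n α →L[ℂ] FockSpace n α).bound
  replace hle : ∀ f, ‖compositionOperator φ hmaps f‖ ≤ M * ‖f‖ := hle
  -- The crude bound M² ≤ exp(M²) replaces a logarithm of the operator norm.
  refine ⟨M ^ 2 / α, by positivity, fun w => ?_⟩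
  have hk : 0 < ‖FockSpace.kernel α (φ w)‖ ^ 2 := by
    rw [FockSpace.norm_sq_kernel]
    have := fockMass_pos (n := n) (α := α)
    positivity
  have h1 := norm_sq_kernel_mul_exp_le (hmaps := hmaps) w
  have h2 := pow_le_pow_left₀ (norm_nonneg _) (hle (FockSpace.kernel α (φ w))) 2
  rw [mul_pow] at h2
  have h3 : Real.exp (α * sqNorm (φ w)) ≤ Real.exp (α * sqNorm w) * M ^ 2 := by
    refine le_of_mul_le_mul_left (h1.trans ?_) hk
    calc _ ≤ Real.exp (α * sqNorm w) * (M ^ 2 * ‖FockSpace.kernel α (φ w)‖ ^ 2) := by gcongr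
      _ = _ := by ring
  have h4 : Real.exp (α * sqNorm (φ w)) ≤ Real.exp (α * sqNorm w + M ^ 2) := by
    rw [Real.exp_add]
    refine h3.trans (mul_le_mul_of_nonneg_left ?_ (Real.exp_pos _).le)
    linarith [Real.add_one_le_exp (M ^ 2)]
  have h5 := Real.exp_le_exp.1 h4
  refine le_of_mul_le_mul_left (h5.trans_eq ?_) hα0
  field_simp

/-- On each complex line through 0 the symbol has linear growth, so the one-variable result applies,
evaluated at t = 1. -/
theorem symbol_eq_affine (hφ : Differentiable ℂ φ) {C : ℝ} (hC : 0 ≤ C)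
    (h : ∀ w, sqNorm (φ w) ≤ sqNorm w + C) (z : Fin n → ℂ) : φ z = fderiv ℂ φ 0 z + φ 0 := by
  have hgrow : ∀ w, ‖φ w‖ ≤ √n * ‖w‖ + √C := fun w => by
    refine le_of_sq_le_sq ?_ (by positivity)
    calc ‖φ w‖ ^ 2 ≤ sqNorm (φ w) := norm_sq_le_sqNorm _
      _ ≤ n * ‖w‖ ^ 2 + C := (h w).trans (add_le_add_left (sqNorm_le_norm_sq w) C)
      _ = √n ^ 2 * ‖w‖ ^ 2 + √C ^ 2 := by rw [Real.sq_sqrt hC, Real.sq_sqrt (Nat.cast_nonneg n)]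
      _ ≤ (√n * ‖w‖ + √C) ^ 2 := by
        have : 0 ≤ √n * ‖w‖ * √C := by positivity
        nlinarith
  have hd : Differentiable ℂ fun t : ℂ => φ (t • z) := hφ.comp (differentiable_id.smul_const z)
  have h1 := eq_add_deriv_of_linear_growth hd (a := √n * ‖z‖) (b := √C) (by positivity)
    (by positivity) (fun t => (hgrow _).trans_eq (by rw [norm_smul]; ring)) 1
  have h2 : deriv (fun t : ℂ => φ (t • z)) 0 = fderiv ℂ φ 0 z := by
    have := (hφ 0).lineDeriv_eq_fderiv (v := z)
    simpa [lineDeriv] using this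
  rw [h2, one_smul, one_smul, zero_smul] at h1
  rw [h1, add_comm]

/-- Normalized reproducing kernels tend to zero pointwise as their base points tend to infinity. -/
theorem norm_kernel_apply_sq_le (v y : Fin n → ℂ) :
    ‖FockSpace.kernel α v y‖ ^ 2 ≤
      (fockMass n α)⁻¹ * Real.exp (2 * α * sqNorm y) * Real.exp (-(α / 2) * sqNorm v) *
        ‖FockSpace.kernel α v‖ ^ 2 := by
  have hα0 := hα.out
  have hm := fockMass_pos (n := n) (α := α)
  -- The factor 2 makes the cross term cost only half of the exponent α|v|² in the squared norm of
  -- the kernel; the other half gives the decay.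
  have h1 := sqNorm_nonneg (v + (-2 : ℂ) • y)
  rw [add_comm, sqNorm_add, sqNorm_smul, hermForm_smul_right, norm_neg, Complex.norm_ofNat] at h1
  have h2 : (-2 * hermForm v y).re = -2 * (hermForm v y).re := by simp
  rw [h2] at h1
  have h3 : (α * hermForm v y).re = α * (hermForm v y).re := Complex.re_ofReal_mul _ _
  rw [FockSpace.norm_sq_kernel, FockSpace.kernel_apply, Complex.norm_exp, h3, ← Real.exp_nat_mul]
  calc Real.exp ((2 : ℕ) * (α * (hermForm v y).re))
      ≤ Real.exp (2 * α * sqNorm y + -(α / 2) * sqNorm v + α * sqNorm v) := by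
        refine Real.exp_le_exp.2 ?_
        push_cast
        nlinarith
    _ = _ := by
        rw [Real.exp_add, Real.exp_add]
        field_simp

open Filter Topology in
/-- The linear part of the symbol of a compact composition operator strictly decreases the
Euclidean norm. -/
theorem sqNorm_linear_lt_of_compact (hcompact : IsCompactOperator (compositionOperator φ hmaps))
    (L : (Fin n → ℂ) →L[ℂ] (Fin n → ℂ)) (b : Fin n → ℂ) (hφ : ∀ z, φ z = L z + b)
    {ζ : Fin n → ℂ} (hζ : ζ ≠ 0) : sqNorm (L ζ) < sqNorm ζ := by
  by_contra! hcon
  -- Replacing ζ by -ζ fixes the sign of the cross term, so that |φ(jζ)| ≥ |jζ| for all j.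
  wlog hre : 0 ≤ (hermForm b (L ζ)).re generalizing ζ
  · have hneg : ∀ z : Fin n → ℂ, sqNorm (-z) = sqNorm z := fun z => by simp [sqNorm]
    refine this (ζ := -ζ) (neg_ne_zero.2 hζ) (by rwa [map_neg, hneg, hneg]) ?_
    have : hermForm b (-L ζ) = -hermForm b (L ζ) := by simp [hermForm]
    rw [map_neg, this, Complex.neg_re]
    linarith
  have hα0 := hα.out
  have hm := fockMass_pos (n := n) (α := α)
  set T := compositionOperator φ hmaps
  have hζ0 : 0 < sqNorm ζ :=
    (by have := norm_pos_iff.2 hζ; positivity : 0 < ‖ζ‖ ^ 2).trans_le (norm_sq_le_sqNorm ζ)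
  set w : ℕ → (Fin n → ℂ) := fun j => (j : ℂ) • ζ with hw
  have hwq : ∀ j, sqNorm (w j) = j ^ 2 * sqNorm ζ := fun j => by simp [hw, sqNorm_smul]
  have hvq : ∀ j, sqNorm (w j) ≤ sqNorm (φ (w j)) := fun j => by
    have hr : ((j : ℂ) * hermForm b (L ζ)).re = j * (hermForm b (L ζ)).re := by simp
    rw [hφ, sqNorm_add, hwq, hw, map_smul, sqNorm_smul, hermForm_smul_right, hr,
      Complex.norm_natCast]
    have h1 := mul_le_mul_of_nonneg_left hcon (sq_nonneg (j : ℝ))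
    have h2 : 0 ≤ (j : ℝ) * (hermForm b (L ζ)).re := by positivity
    linarith [sqNorm_nonneg b]
  set k : ℕ → FockSpace n α := fun j => FockSpace.kernel α (φ (w j)) with hk
  have hk0 : ∀ j, 0 < ‖k j‖ := fun j => by
    have h : 0 < ‖k j‖ ^ 2 := by
      rw [hk, FockSpace.norm_sq_kernel]
      positivity
    exact lt_of_le_of_ne (norm_nonneg _) fun h0 => by simp [← h0] at h
  have hTk : ∀ j, ‖k j‖ ≤ ‖T (k j)‖ := fun j => by
    refine le_of_sq_le_sq ?_ (norm_nonneg _)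
    have h1 := norm_sq_kernel_mul_exp_le (hmaps := hmaps) (w j)
    have h2 : Real.exp (α * sqNorm (w j)) ≤ Real.exp (α * sqNorm (φ (w j))) :=
      Real.exp_le_exp.2 (mul_le_mul_of_nonneg_left (hvq j) hα0.le)
    refine le_of_mul_le_mul_left ?_ (Real.exp_pos (α * sqNorm (w j)))
    refine le_trans ?_ h1
    rw [mul_comm]
    exact mul_le_mul_of_nonneg_left h2 (sq_nonneg _)
  set f : ℕ → FockSpace n α := fun j => ((‖k j‖ : ℂ)⁻¹) • k j with hf
  have hf1 : ∀ j, ‖f j‖ = 1 := fun j => by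
    rw [hf, norm_smul, norm_inv, Complex.norm_real, norm_norm, inv_mul_cancel₀ (hk0 j).ne']
  have hTf : ∀ j, 1 ≤ ‖T (f j)‖ := fun j => by
    rw [hf, map_smul, norm_smul, norm_inv, Complex.norm_real, norm_norm, le_inv_mul_iff₀ (hk0 j),
      mul_one]
    exact hTk j
  obtain ⟨K, hK, hTK⟩ := hcompact.image_closedBall_subset_compact (𝕜₁ := ℂ) 1
  obtain ⟨h, -, g, hg, hlim⟩ := hK.tendsto_subseq (x := fun j => T (f j))
    fun j => hTK ⟨f j, by simp [hf1 j], rfl⟩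
  have hh1 : 1 ≤ ‖h‖ := ge_of_tendsto hlim.norm (Eventually.of_forall fun j => hTf (g j))
  have hzero : ∀ y, Tendsto (fun j => ‖f j y‖ ^ 2) atTop (𝓝 0) := by
    intro y
    have hexp : Tendsto (fun j : ℕ => Real.exp (-(α / 2) * (j ^ 2 * sqNorm ζ))) atTop (𝓝 0) := by
      refine Real.tendsto_exp_atBot.comp ?_
      have : Tendsto (fun j : ℕ => (j : ℝ) ^ 2) atTop atTop :=
        (tendsto_pow_atTop two_ne_zero).comp tendsto_natCast_atTop_atTop
      exact (this.atTop_mul_const hζ0).const_mul_atTop_of_neg (by linarith)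
    have hexp' := hexp.const_mul ((fockMass n α)⁻¹ * Real.exp (2 * α * sqNorm y))
    rw [mul_zero] at hexp'
    refine squeeze_zero (fun j => sq_nonneg _) (fun j => ?_) hexp'
    rw [hf, FockSpace.coe_smul, norm_mul, norm_inv, Complex.norm_real, norm_norm, mul_pow, inv_pow,
      inv_mul_le_iff₀ (pow_pos (hk0 j) 2), mul_comm (‖k j‖ ^ 2)]
    refine (norm_kernel_apply_sq_le _ _).trans ?_
    have : -(α / 2) * sqNorm (φ (w j)) ≤ -(α / 2) * (j ^ 2 * sqNorm ζ) := by
      rw [← hwq]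
      exact mul_le_mul_of_nonpos_left (hvq j) (by linarith)
    gcongr
  -- Norm convergence implies pointwise convergence, and T f_j(z) = f_j(φ(z)) tends to 0.
  have hh0 : h = 0 := by
    refine Subtype.ext (funext fun z => ?_)
    obtain ⟨B, -, hB⟩ := FockSpace.exists_norm_apply_le n α ‖z‖
    have h1 : Tendsto (fun j => T (f (g j)) z) atTop (𝓝 (h z)) := by
      rw [tendsto_iff_norm_sub_tendsto_zero]
      have h2 := (tendsto_iff_norm_sub_tendsto_zero.1 hlim).const_mul B
      rw [mul_zero] at h2
      exact squeeze_zero (fun j => norm_nonneg _)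
        (fun j => hB (T (f (g j)) - h) z le_rfl) h2
    have h3 := ((hzero (φ z)).comp hg.tendsto_atTop)
    have h4 : ‖h z‖ ^ 2 = 0 := tendsto_nhds_unique (h1.norm.pow 2) h3
    exact norm_eq_zero.1 (pow_eq_zero_iff two_ne_zero |>.1 h4)
  rw [hh0, norm_zero] at hh1
  exact absurd hh1 (by norm_num)

end Symbol

end

theorem theorem2p2 (n : ℕ) (α : ℝ) [Fact (0 < α)] (φ : (Fin n → ℂ) → (Fin n → ℂ))
    (hφ : Differentiable ℂ φ)
    (hmaps : ∀ f : FockSpace n α, (f : (Fin n → ℂ) → ℂ) ∘ φ ∈ fockSubmodule n α)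
    (hcompact : IsCompactOperator (compositionOperator φ hmaps)) :
    ∀ p : ℝ, 0 < p → MemSchatten p (compositionOperator φ hmaps) := by
  intro p hp
  obtain ⟨C, hC, hle⟩ := exists_sqNorm_symbol_le hcompact.continuous
  have haff := symbol_eq_affine hφ hC hle
  have hcontr : IsAsymptoticContraction φ := by
    rw [funext haff]
    exact isAsymptoticContraction_of_affine _
      (fun z hz => sqNorm_linear_lt_of_compact hcompact _ _ haff hz) _
  exact GelfandDecay.memSchatten hcompact (fun m => hcontr.gelfandDecay m) hp
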